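/- Let $d\ge 1$. There is a constant $C$, depending only on $d$, such that the following holds. Let $\ell,w>0$, let $\mathsf C\subset\mathbb R^d$ be a closed $d$-dimensional cube of side length $\ell$ (in any position and orientation), and let $P\subset\mathsf C$ be a finite set. A matching of $P$ is a set of unordered pairs of distinct points of $P$ such that every point of $P$ lies in exactly one pair. Let $M$ be a min-cost matching of $P$, i.e. a matching that minimizes $\sum_{\{p,q\}\in M}\|p-q\|$ among all matchings of $P$. For a unit vector $u\in\mathbb R^d$ and $c\in\mathbb R$ let $$S_w=\{x\in\mathsf C : |\langle u,x\rangle-c|\le w\}$$ be a slab of width $2w$ restricted to $\mathsf C$. For an edge $\{p,q\}\in M$ whose segment $\overline{pq}$ meets $S_w$, let $p_B$ (resp. $q_B$) be the point of $\overline{pq}\cap S_w$ closest to $p$ (resp. $q$); edges whose segment does not meet $S_w$ contribute $0$ to the sum below. Then $$\rho(S_w,M):=\sum_{\{p,q\}\in M}\min\{(2w)^d,\ \|p_B-q_B\|^d\}\ \le\ C\,\ell^{d-1}w .$$ -/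

import Mathlib

noncomputable section

namespace MinCostMatching

/-- Points of `d`-dimensional Euclidean space. -/
abbrev Pt (d : ℕ) : Type := EuclideanSpace ℝ (Fin d)

/-- The closed cube of side length `l` with corner `a` whose edge directions are the vectors of the
orthonormal basis `b` (so the cube need not be axis-parallel). -/
def cube {d : ℕ} (b : OrthonormalBasis (Fin d) ℝ (Pt d)) (a : Pt d) (l : ℝ) : Set (Pt d) :=
  {x | ∀ i, 0 ≤ inner ℝ (b i) (x - a) ∧ inner ℝ (b i) (x - a) ≤ l}

/-- For a unit vector `u`: the closed slab of width `2 * w` around the hyperplane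
`{x | ⟪u, x⟫ = c}`, that is, the set of points at distance at most `w` from that hyperplane. -/
def slab {d : ℕ} (u : Pt d) (c w : ℝ) : Set (Pt d) :=
  {x | |inner ℝ u x - c| ≤ w}

/-- `M` is a (perfect) matching of the finite point set `P`: a set of unordered pairs of distinct
points of `P` such that every point of `P` lies in exactly one pair. -/
structure IsMatching {d : ℕ} (P : Finset (Pt d)) (M : Finset (Sym2 (Pt d))) : Prop where
  not_isDiag : ∀ e ∈ M, ¬ e.IsDiag
  mem_of_mem : ∀ e ∈ M, ∀ p ∈ e, p ∈ P
  existsUnique : ∀ p ∈ P, ∃! e, e ∈ M ∧ p ∈ e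

/-- The Euclidean length of the edge `{p, q}`. -/
def edgeLength {d : ℕ} : Sym2 (Pt d) → ℝ :=
  Sym2.lift ⟨fun p q => dist p q, fun p q => dist_comm p q⟩

/-- The cost of a matching: the sum of its edge lengths. -/
def cost {d : ℕ} (M : Finset (Sym2 (Pt d))) : ℝ := ∑ e ∈ M, edgeLength e

/-- `M` is a min-cost matching of `P`. -/
def IsMinCostMatching {d : ℕ} (P : Finset (Pt d)) (M : Finset (Sym2 (Pt d))) : Prop :=
  IsMatching P M ∧ ∀ M' : Finset (Sym2 (Pt d)), IsMatching P M' → cost M ≤ cost M'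

open Classical in
/-- The point of `segment p q` inside `O` that is closest to `p`. It exists (and is unique) whenever
`O` is closed and meets the segment; the value is `p` if there is no closest point. -/
def clipPoint {d : ℕ} (O : Set (Pt d)) (p q : Pt d) : Pt d :=
  if h : ∃ x ∈ segment ℝ p q ∩ O, ∀ y ∈ segment ℝ p q ∩ O, dist p x ≤ dist p y then h.choose else p

open Classical in
/-- The length of the part of the edge `{p, q}` inside `O`: the distance from the point of
`segment p q` inside `O` closest to `p` to the one closest to `q`; it is `0` when the segment does
not meet `O`. -/
def clippedLength {d : ℕ} (O : Set (Pt d)) : Sym2 (Pt d) → ℝ :=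
  Sym2.lift ⟨fun p q =>
    if (segment ℝ p q ∩ O).Nonempty then dist (clipPoint O p q) (clipPoint O q p) else 0, by
      intro p q
      simp only [segment_symm ℝ q p, dist_comm (clipPoint O q p)]⟩

/-- The truncated length of the matching `M` restricted to the object `O` of size parameter `w`. -/
def rho {d : ℕ} (w : ℝ) (O : Set (Pt d)) (M : Finset (Sym2 (Pt d))) : ℝ :=
  ∑ e ∈ M, min ((2 * w) ^ d) (clippedLength O e ^ d)

end MinCostMatching

end

/-! Write `d = n + 1`. Minimality is used only as `AltOptimal`: no exchange along an alternating
cycle shortens the matching. By the triangle inequality this passes to subsegments, so each edge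
meeting the restricted slab is cut to a piece that starts there and has length `min (2 * w)
(clippedLength O e)`. The pieces have midpoints in a slab of half-width `O(w)` and a ball of radius
`O(l)`, and it remains to bound the sum of `δ ^ d` over their lengths `δ`.

Put a ball of radius `ε * δ` around each midpoint and select greedily, by decreasing length, edges
with disjoint balls. A line normal to the slab meets the half-size balls in disjoint intervals, so
the selected edges it meets have total length `O(w / ε)`. Integrating over all such lines gives `O(l
^ (d - 1) * w)` for the selected edges.

Every other edge is dominated by a selected one, so it suffices that an edge `e` of length `L`
dominates only `O(L ^ d)` (`AltOptimal.sum_dominated_le`). Dominated edges of length comparable to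
`L` are bounded in number, because two nearly equal edges could be swapped. For much shorter ones,
`e` can be rerouted along a line parallel to it at distance `O(ε * L)`. By Pythagoras the detour
costs only `O(ε ^ 2 * L)`, while every short edge passed on the way saves a fixed fraction of its
length. Hence edges well spaced on the line have total length `O(ε ^ 2 * L)`, and all edges with
disjoint balls on it `O(ε * L)`. Averaging over the lines, a small `ε` leaves at most `L ^ d / 2`
for a disjoint family of short edges, and this factor `1 / 2` makes the recursion over dominated
edges a convergent geometric series. -/

open MeasureTheory Metric

namespace MinCostMatching

/-! ### Volume averaging over balls. -/

section Averaging

variable {F ι : Type*} [NormedAddCommGroup F] [NormedSpace ℝ F] [FiniteDimensional ℝ F]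

open Classical in
/-- If every point lies in closed balls of total weight at most `B`, then the volumes of these
balls, weighted accordingly, add up to at most `B` times the volume of a ball containing them. -/
theorem sum_mul_pow_finrank_le (s : Finset ι) (z : ι → F) (r δ : ι → ℝ) (y₀ : F) (B R : ℝ)
    (hR : 0 ≤ R) (hr : ∀ i ∈ s, 0 ≤ r i) (hδ : ∀ i ∈ s, 0 ≤ δ i)
    (hin : ∀ i ∈ s, dist (z i) y₀ + r i ≤ R)
    (hB : ∀ y, ∑ i ∈ s with dist y (z i) ≤ r i, δ i ≤ B) :
    ∑ i ∈ s, δ i * r i ^ Module.finrank ℝ F ≤ B * R ^ Module.finrank ℝ F := by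
  borelize F
  set μ : Measure F := Measure.addHaar
  set n := Module.finrank ℝ F
  have hB0 : 0 ≤ B := (Finset.sum_nonneg fun i hi => hδ i (Finset.mem_filter.1 hi).1).trans (hB y₀)
  have hω0 : 0 < μ.real (ball (0 : F) 1) :=
    ENNReal.toReal_pos (measure_ball_pos μ _ one_pos).ne' measure_ball_lt_top.ne
  have hvol : ∀ (x : F) (t : ℝ), 0 ≤ t →
      μ.real (closedBall x t) = t ^ n * μ.real (ball (0 : F) 1) := fun x t ht => by
    rw [Measure.real, Measure.addHaar_closedBall μ x ht, ENNReal.toReal_mul,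
      ENNReal.toReal_ofReal (by positivity)]
    rfl
  have hint : ∀ (x : F) (t c : ℝ),
      Integrable ((closedBall x t).indicator fun _ => c) μ := fun x t c =>
    (integrable_indicator_iff measurableSet_closedBall).2
      (integrableOn_const measure_closedBall_lt_top.ne)
  have hval : ∀ (x : F) (t c : ℝ), 0 ≤ t →
      ∫ y, (closedBall x t).indicator (fun _ => c) y ∂μ
        = c * t ^ n * μ.real (ball (0 : F) 1) := fun x t c ht => by
    rw [integral_indicator measurableSet_closedBall, setIntegral_const, hvol x t ht, smul_eq_mul]
    ring
  have key : ∫ y, ∑ i ∈ s, (closedBall (z i) (r i)).indicator (fun _ => δ i) y ∂μ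
      ≤ ∫ y, (closedBall y₀ R).indicator (fun _ => B) y ∂μ := by
    refine integral_mono (integrable_finsetSum _ fun i _ => hint _ _ _) (hint _ _ _) fun y => ?_
    have h1 : ∑ i ∈ s, (closedBall (z i) (r i)).indicator (fun _ => δ i) y
        = ∑ i ∈ s with dist y (z i) ≤ r i, δ i := by
      rw [Finset.sum_filter]
      rfl
    by_cases hy : y ∈ closedBall y₀ R
    · simp only [Set.indicator_of_mem hy, h1]
      exact hB y
    · simp only [Set.indicator_of_notMem hy]
      refine (Finset.sum_eq_zero fun i hi => Set.indicator_of_notMem (fun h => hy ?_) _).le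
      rw [mem_closedBall] at h ⊢
      linarith [dist_triangle y (z i) y₀, hin i hi]
  rw [integral_finsetSum _ fun i _ => hint _ _ _, hval _ _ _ hR,
    Finset.sum_congr rfl fun i hi => hval (z i) (r i) (δ i) (hr i hi), ← Finset.sum_mul] at key
  exact le_of_mul_le_mul_right key hω0

/-- Disjoint closed balls inside a ball satisfy the volume bound. -/
theorem sum_pow_finrank_le_of_separated (s : Finset ι) (z : ι → F) (r : ι → ℝ) (y₀ : F) (R : ℝ)
    (hR : 0 ≤ R) (hr : ∀ i ∈ s, 0 ≤ r i) (hin : ∀ i ∈ s, dist (z i) y₀ + r i ≤ R)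
    (hsep : ∀ i ∈ s, ∀ j ∈ s, i ≠ j → r i + r j < dist (z i) (z j)) :
    ∑ i ∈ s, r i ^ Module.finrank ℝ F ≤ R ^ Module.finrank ℝ F := by
  classical
  have := sum_mul_pow_finrank_le s z r (fun _ => 1) y₀ 1 R hR hr (fun _ _ => zero_le_one) hin
    (fun y => by
      rw [Finset.sum_const, nsmul_eq_mul, mul_one]
      norm_cast
      -- With unit weights the total weight at a point counts the balls containing it, which is at
      -- most one by disjointness.
      refine Finset.card_le_one.2 fun i hi j hj => ?_
      rw [Finset.mem_filter] at hi hj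
      by_contra hij
      linarith [hsep i hi.1 j hj.1 hij, dist_triangle_left (z i) (z j) y])
  simpa using this

end Averaging

/-! ### Greedy selection and charging. -/

/-- Greedy selection by decreasing size: a conflict-free subfamily such that every member of the
family is selected or in conflict with a selected one of at least its size. -/
theorem exists_greedy {ι : Type*} (s : Finset ι) (size : ι → ℝ) (conflict : ι → ι → Prop)
    (hsymm : ∀ i j, conflict i j → conflict j i) :
    ∃ G ⊆ s, (∀ i ∈ G, ∀ j ∈ G, i ≠ j → ¬ conflict i j) ∧
      ∀ i ∈ s, ∃ g ∈ G, size i ≤ size g ∧ (i = g ∨ conflict i g) := by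
  classical
  induction s using Finset.strongInduction with
  | _ s ih =>
    rcases s.eq_empty_or_nonempty with rfl | hs
    · exact ⟨∅, by simp⟩
    · obtain ⟨m, hm, hmax⟩ := s.exists_max_image size hs
      -- Take a largest member, discard it with everything in conflict with it, and recurse on the
      -- rest.
      set t := s.filter fun i => ¬ (i = m ∨ conflict i m)
      have ht : t ⊂ s := Finset.filter_ssubset.2 ⟨m, hm, by simp⟩
      obtain ⟨G, hG, hfree, hdom⟩ := ih t ht
      have hGt : ∀ i ∈ G, i ≠ m ∧ ¬ conflict i m := fun i hi => by
        simpa [t] using (Finset.mem_filter.1 (hG hi)).2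
      refine ⟨insert m G, Finset.insert_subset hm (hG.trans ht.1), ?_, fun i hi => ?_⟩
      · simp only [Finset.mem_insert]
        rintro i (rfl | hi) j (rfl | hj) hij
        · exact (hij rfl).elim
        · exact fun h => (hGt j hj).2 (hsymm _ _ h)
        · exact (hGt i hi).2
        · exact hfree i hi j hj hij
      · by_cases him : i = m ∨ conflict i m
        · exact ⟨m, Finset.mem_insert_self _ _, hmax i hi, him⟩
        · obtain ⟨g, hg, h⟩ := hdom i (Finset.mem_filter.2 ⟨hi, him⟩)
          exact ⟨g, Finset.mem_insert_of_mem hg, h⟩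

/-- If each member of `s` is charged to some `g ∈ G`, the sum over `s` is at most the sum over `G`
of bounds for the charged parts. -/
theorem sum_le_sum_of_charge {ι : Type*} (s G : Finset ι) (f c : ι → ℝ) (charge : ι → ι → Prop)
    [∀ g, DecidablePred (charge g)] (hf : ∀ i ∈ s, 0 ≤ f i)
    (hex : ∀ i ∈ s, ∃ g ∈ G, charge g i)
    (hle : ∀ g ∈ G, ∑ i ∈ s with charge g i, f i ≤ c g) :
    ∑ i ∈ s, f i ≤ ∑ g ∈ G, c g := by
  calc ∑ i ∈ s, f i ≤ ∑ i ∈ s, ∑ g ∈ G, if charge g i then f i else 0 := by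
        refine Finset.sum_le_sum fun i hi => ?_
        obtain ⟨g, hg, h⟩ := hex i hi
        calc f i = if charge g i then f i else 0 := (if_pos h).symm
          _ ≤ _ := Finset.single_le_sum (f := fun g => if charge g i then f i else 0)
            (fun g _ => by split_ifs; exacts [hf i hi, le_rfl]) hg
    _ = ∑ g ∈ G, ∑ i ∈ s with charge g i, f i := by
        rw [Finset.sum_comm]
        simp only [Finset.sum_filter]
    _ ≤ ∑ g ∈ G, c g := Finset.sum_le_sum hle

/-! ### Alternating cycles and chains. -/

section Alternating

variable {E ι : Type*} [PseudoMetricSpace E]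

/-- The length of the alternating path `x, a i₁, b i₁, a i₂, …, b iₖ, y`, where the edges
`(a i, b i)` with `i` in the list are counted negatively and the connections positively. -/
def altCost (a b : ι → E) : E → List ι → E → ℝ
  | x, [], y => dist x y
  | x, i :: l, y => dist x (a i) - dist (a i) (b i) + altCost a b (b i) l y

/-- No alternating cycle through the edges `(p i, q i)` decreases the total length. -/
def AltOptimal (p q : ι → E) : Prop :=
  ∀ a b : ι → E, (∀ i, (a i = p i ∧ b i = q i) ∨ (a i = q i ∧ b i = p i)) →
    ∀ (i : ι) (l : List ι), (i :: l).Nodup → dist (a i) (b i) ≤ altCost a b (a i) l (b i)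

/-- This is the alternating cycle through just two edges. -/
theorem AltOptimal.dist_add_dist_le {p q : ι → E} (h : AltOptimal p q) {i j : ι} (hij : i ≠ j) :
    dist (p i) (q i) + dist (p j) (q j) ≤ dist (p i) (p j) + dist (q i) (q j) := by
  have := h p q (fun _ => Or.inl ⟨rfl, rfl⟩) i [j] (by simpa using hij)
  simp only [altCost] at this
  rw [dist_comm (q i)]
  linarith

/-- The positions `t` telescope. Each edge is subtracted once and pays a quarter of its length to
each of its two adjacent connections, so half of it remains as gain. The first edge `j` has already
been subtracted by the caller, hence its separate quarter. -/
theorem altCost_le_of_step (a b : ι → E) (y : E) (t : ι → ℝ) (T κ : ℝ) :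
    ∀ (j : ι) (l : List ι),
      (j :: l).Pairwise (fun i k => dist (b i) (a k)
        ≤ t k - t i + (dist (a i) (b i) + dist (a k) (b k)) / 4) →
      (∀ i ∈ j :: l, dist (b i) y ≤ T - t i + κ + dist (a i) (b i) / 4) →
      altCost a b (b j) l y
        ≤ T - t j + κ + dist (a j) (b j) / 4 - (l.map fun i => dist (a i) (b i)).sum / 2
  | j, [], _, hy => by simpa [altCost] using hy j
  | j, i :: l, hp, hy => by
    have ih := altCost_le_of_step a b y t T κ i l (List.pairwise_cons.1 hp).2
      fun k hk => hy k (List.mem_cons_of_mem _ hk)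
    have h1 := (List.pairwise_cons.1 hp).1 i (by simp)
    simp only [altCost, List.map_cons, List.sum_cons]
    linarith

/-- Along an optimal edge, a chain of edges met in order by a nearby parallel line has total length
at most the excess of the detour. -/
theorem AltOptimal.sum_le_of_chain {p q : ι → E} (h : AltOptimal p q) (a b : ι → E)
    (hab : ∀ i, (a i = p i ∧ b i = q i) ∨ (a i = q i ∧ b i = p i)) (e : ι) (s : Finset ι)
    (he : e ∉ s) (t : ι → ℝ) (T₀ T₁ κ : ℝ) (hκ : 0 ≤ κ) (hT : dist (a e) (b e) = T₁ - T₀)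
    (hstep : ∀ i ∈ s, ∀ k ∈ s, i ≠ k → t i ≤ t k → dist (b i) (a k)
        ≤ t k - t i + (dist (a i) (b i) + dist (a k) (b k)) / 4)
    (hstart : ∀ i ∈ s, dist (a e) (a i) ≤ t i - T₀ + κ + dist (a i) (b i) / 4)
    (hend : ∀ i ∈ s, dist (b i) (b e) ≤ T₁ - t i + κ + dist (a i) (b i) / 4) :
    ∑ i ∈ s, dist (a i) (b i) ≤ 4 * κ := by
  classical
  set l := s.toList.insertionSort fun i k => t i ≤ t k
  have hperm : l.Perm s.toList := List.perm_insertionSort _ _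
  have hmem : ∀ i, i ∈ l ↔ i ∈ s := fun i => hperm.mem_iff.trans Finset.mem_toList
  have hnd : l.Nodup := hperm.nodup_iff.2 s.nodup_toList
  have hsort : l.Pairwise fun i k => t i ≤ t k := by
    have : Std.Total fun i k => t i ≤ t k := ⟨fun i k => le_total _ _⟩
    have : IsTrans ι fun i k => t i ≤ t k := ⟨fun _ _ _ => le_trans⟩
    exact List.pairwise_insertionSort _ _
  have hsum : ∑ i ∈ s, dist (a i) (b i) = (l.map fun i => dist (a i) (b i)).sum := by
    rw [← Finset.sum_map_toList]
    exact ((hperm.map _).sum_eq).symm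
  have hp : l.Pairwise fun i k => dist (b i) (a k)
        ≤ t k - t i + (dist (a i) (b i) + dist (a k) (b k)) / 4 :=
    (hsort.and hnd).imp_of_mem fun hi hk hik =>
      hstep _ ((hmem _).1 hi) _ ((hmem _).1 hk) hik.2 hik.1
  have hopt := h a b hab e l (List.nodup_cons.2 ⟨fun hm => he ((hmem e).1 hm), hnd⟩)
  have hin : ∀ i ∈ l, i ∈ s := fun i => (hmem i).1
  rw [hsum]
  cases hl : l with
  | nil => simpa using hκ
  | cons i l' =>
    rw [hl] at hopt hp hin
    have h1 := altCost_le_of_step a b (b e) t T₁ κ i l' hp fun k hk => hend k (hin k hk)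
    have h2 := hstart i (hin i (by simp))
    simp only [altCost, List.map_cons, List.sum_cons] at hopt ⊢
    -- Start and end cost `κ` each and the chain gains half its total length, so optimality gives
    -- that half at most `2 * κ`.
    linarith

end Alternating

/-! ### Components along and across a direction. -/

section Line

variable {E : Type*} [NormedAddCommGroup E] [InnerProductSpace ℝ E]

/-- The component of `x` perpendicular to `v` (for a unit vector `v`). -/
def perp (v x : E) : E := x - (inner ℝ v x : ℝ) • v

theorem perp_sub (v x y : E) : perp v (x - y) = perp v x - perp v y := by
  simp only [perp, inner_sub_right, sub_smul]
  abel

theorem perp_mem {v : E} (hv : ‖v‖ = 1) (x : E) : perp v x ∈ (ℝ ∙ v)ᗮ := by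
  rw [Submodule.mem_orthogonal_singleton_iff_inner_right, perp, inner_sub_right, inner_smul_right,
    real_inner_self_eq_norm_sq, hv]
  ring

theorem norm_sq_eq {v : E} (hv : ‖v‖ = 1) (x : E) :
    ‖x‖ ^ 2 = (inner ℝ v x : ℝ) ^ 2 + ‖perp v x‖ ^ 2 := by
  rw [perp, norm_sub_sq_real, norm_smul, hv, inner_smul_right, real_inner_comm, Real.norm_eq_abs,
    mul_one, sq_abs]
  ring

theorem norm_perp_le {v : E} (hv : ‖v‖ = 1) (x : E) : ‖perp v x‖ ≤ ‖x‖ := by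
  have := norm_sq_eq hv x
  exact abs_le_of_sq_le_sq' (by nlinarith [sq_nonneg (inner ℝ v x : ℝ)]) (norm_nonneg _) |>.2

theorem abs_inner_le {v : E} (hv : ‖v‖ = 1) (x : E) : |(inner ℝ v x : ℝ)| ≤ ‖x‖ := by
  simpa [hv] using abs_real_inner_le_norm v x

theorem norm_le_abs_inner_add {v : E} (hv : ‖v‖ = 1) (x : E) :
    ‖x‖ ≤ |(inner ℝ v x : ℝ)| + ‖perp v x‖ := by
  refine abs_le_of_sq_le_sq' ?_ (by positivity) |>.2
  rw [norm_sq_eq hv x, ← sq_abs (inner ℝ v x : ℝ)]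
  nlinarith [mul_nonneg (abs_nonneg (inner ℝ v x : ℝ)) (norm_nonneg (perp v x))]

/-- `D ^ 2 + h ^ 2 ≤ (D + c) ^ 2`: a perpendicular offset `h` over a distance `D` costs only about
`h ^ 2 / (2 * D)`. This quadratic saving is what makes rerouting along a parallel line cheap. -/
theorem norm_le_add_of_sq {v : E} (hv : ‖v‖ = 1) {x : E} {D h c : ℝ}
    (hD : |(inner ℝ v x : ℝ)| ≤ D) (hh : ‖perp v x‖ ≤ h) (hc : 0 ≤ c) (hle : h ^ 2 ≤ 2 * D * c) :
    ‖x‖ ≤ D + c := by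
  have hD0 := (abs_nonneg _).trans hD
  refine abs_le_of_sq_le_sq' ?_ (by positivity) |>.2
  rw [norm_sq_eq hv x, ← sq_abs (inner ℝ v x : ℝ)]
  have h1 := pow_le_pow_left₀ (abs_nonneg _) hD 2
  have h2 := pow_le_pow_left₀ (norm_nonneg _) hh 2
  nlinarith [sq_nonneg c]

end Line

/-! ### Total length of the edges met by one line. -/

section LineBounds

variable {E ι : Type*} [NormedAddCommGroup E] [InnerProductSpace ℝ E]

/-- Separated balls whose centres are close to a line in direction `v` cut out disjoint intervals
of that line. -/
theorem sum_le_of_near_line {v : E} (hv : ‖v‖ = 1) (s : Finset ι) (m : ι → E) (r : ι → ℝ)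
    (hr : ∀ i ∈ s, 0 ≤ r i)
    (hsep : ∀ i ∈ s, ∀ j ∈ s, i ≠ j → 2 * (r i + r j) < dist (m i) (m j)) (y : E)
    (hy : ∀ i ∈ s, ‖perp v (m i) - y‖ ≤ r i) (t₀ R : ℝ) (hR : 0 ≤ R)
    (hin : ∀ i ∈ s, |inner ℝ v (m i) - t₀| + r i ≤ R) : ∑ i ∈ s, r i ≤ R := by
  have := sum_pow_finrank_le_of_separated s (fun i => (inner ℝ v (m i) : ℝ)) r t₀ R hR hr
    (fun i hi => by simpa [Real.dist_eq] using hin i hi) fun i hi j hj hij => by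
      -- Two centres differ by at most `r i + r j` across the line, so the factor 2 in the
      -- separation leaves more than `r i + r j` along it.
      have h1 := norm_le_abs_inner_add hv (m i - m j)
      have h2 : ‖perp v (m i - m j)‖ ≤ r i + r j := by
        rw [perp_sub, ← sub_sub_sub_cancel_right _ _ y]
        exact (norm_sub_le _ _).trans (add_le_add (hy i hi) (hy j hj))
      have h3 := hsep i hi j hj hij
      rw [dist_eq_norm] at h3
      rw [Real.dist_eq, ← inner_sub_right]
      linarith
  simpa using this

/-- The edges `i ∈ s`, all short compared to the edge `e`, close to its midpoint, and with
separated midpoints, that are met by a line parallel to `e`, have small total length. -/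
theorem AltOptimal.sum_le_of_near_line {p q : ι → E} (h : AltOptimal p q) {ε : ℝ} (hε : 0 < ε)
    (hε8 : ε ≤ 1 / 8) (e : ι) (he : 0 < dist (p e) (q e)) {v : E} (hv : ‖v‖ = 1)
    (hve : q e - p e = dist (p e) (q e) • v) (s : Finset ι)
    (hsep : ∀ i ∈ s, ∀ j ∈ s, i ≠ j → ε * (dist (p i) (q i) + dist (p j) (q j))
      < dist (midpoint ℝ (p i) (q i)) (midpoint ℝ (p j) (q j)))
    (hsmall : ∀ i ∈ s, dist (p i) (q i) ≤ dist (p e) (q e) / 16)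
    (hnear : ∀ i ∈ s, dist (midpoint ℝ (p i) (q i)) (midpoint ℝ (p e) (q e))
      ≤ ε * (dist (p i) (q i) + dist (p e) (q e))) (y : E)
    (hy : ∀ i ∈ s, ‖perp v (midpoint ℝ (p i) (q i)) - y‖ ≤ ε * dist (p i) (q i) / 2) :
    ∑ i ∈ s, dist (p i) (q i) ≤ 1440 * ε * dist (p e) (q e) := by
  classical
  set δ : ι → ℝ := fun i => dist (p i) (q i) with hδ
  set m : ι → E := fun i => midpoint ℝ (p i) (q i) with hm
  set t : ι → ℝ := fun i => inner ℝ v (m i) with ht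
  set L := dist (p e) (q e) with hL
  have hδ0 : ∀ i, 0 ≤ δ i := fun i => dist_nonneg
  -- Orient every edge forward along `v`, so that the chain enters at `a i` and leaves at `b i`.
  set a : ι → E := fun i => if (inner ℝ v (p i) : ℝ) ≤ inner ℝ v (q i) then p i else q i with ha
  set b : ι → E := fun i => if (inner ℝ v (p i) : ℝ) ≤ inner ℝ v (q i) then q i else p i with hb
  have hab : ∀ i, (a i = p i ∧ b i = q i) ∨ (a i = q i ∧ b i = p i) := fun i => by
    by_cases hi : (inner ℝ v (p i) : ℝ) ≤ inner ℝ v (q i)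
    · exact Or.inl ⟨if_pos hi, if_pos hi⟩
    · exact Or.inr ⟨if_neg hi, if_neg hi⟩
  have hdab : ∀ i, dist (a i) (b i) = δ i := fun i => by
    rcases hab i with ⟨h1, h2⟩ | ⟨h1, h2⟩
    · rw [h1, h2]
    · rw [h1, h2, dist_comm]
  have hmid : ∀ i, midpoint ℝ (a i) (b i) = m i := fun i => by
    rcases hab i with ⟨h1, h2⟩ | ⟨h1, h2⟩
    · rw [h1, h2]
    · rw [h1, h2, midpoint_comm]
  have hord : ∀ i, (inner ℝ v (a i) : ℝ) ≤ inner ℝ v (b i) := fun i => by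
    by_cases hi : (inner ℝ v (p i) : ℝ) ≤ inner ℝ v (q i)
    · simpa only [ha, hb, if_pos hi] using hi
    · simpa only [ha, hb, if_neg hi] using (not_le.1 hi).le
  have hdam : ∀ i, ‖a i - m i‖ = δ i / 2 := fun i => by
    rw [← dist_eq_norm, ← hmid, dist_left_midpoint, hdab]
    norm_num
    ring
  have hdbm : ∀ i, ‖b i - m i‖ = δ i / 2 := fun i => by
    rw [← dist_eq_norm, ← hmid, dist_right_midpoint, hdab]
    norm_num
    ring
  have htm : ∀ i, t i = ((inner ℝ v (a i) : ℝ) + inner ℝ v (b i)) / 2 := fun i => by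
    simp only [ht]
    rw [← hmid, midpoint_eq_smul_add, inner_smul_right, inner_add_right, invOf_eq_inv]
    ring
  have hta : ∀ i, t i - δ i / 2 ≤ inner ℝ v (a i) ∧ (inner ℝ v (a i) : ℝ) ≤ t i := fun i => by
    have h1 := abs_le.1 (abs_inner_le hv (a i - m i))
    rw [hdam, inner_sub_right] at h1
    exact ⟨by simp only [ht]; linarith, by linarith [htm i, hord i]⟩
  have htb : ∀ i, t i ≤ inner ℝ v (b i) ∧ (inner ℝ v (b i) : ℝ) ≤ t i + δ i / 2 := fun i => by
    have h1 := abs_le.1 (abs_inner_le hv (b i - m i))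
    rw [hdbm, inner_sub_right] at h1
    exact ⟨by linarith [htm i, hord i], by simp only [ht]; linarith⟩
  have hpa : ∀ i, ‖perp v (a i) - perp v (m i)‖ ≤ δ i / 2 := fun i => by
    rw [← perp_sub, ← hdam]
    exact norm_perp_le hv _
  have hpb : ∀ i, ‖perp v (b i) - perp v (m i)‖ ≤ δ i / 2 := fun i => by
    rw [← perp_sub, ← hdbm]
    exact norm_perp_le hv _
  have hεδ : ∀ i, ε * δ i ≤ δ i := fun i => by nlinarith [hδ0 i]
  have hpay : ∀ i ∈ s, ‖perp v (a i) - y‖ ≤ δ i := fun i hi => by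
    have h1 := norm_sub_le_norm_sub_add_norm_sub (perp v (a i)) (perp v (m i)) y
    linarith [hpa i, hy i hi, hεδ i]
  have hpby : ∀ i ∈ s, ‖perp v (b i) - y‖ ≤ δ i := fun i hi => by
    have h1 := norm_sub_le_norm_sub_add_norm_sub (perp v (b i)) (perp v (m i)) y
    linarith [hpb i, hy i hi, hεδ i]
  -- the long edge
  have hinner_e : (inner ℝ v (q e) : ℝ) - inner ℝ v (p e) = L := by
    rw [← inner_sub_right, hve, inner_smul_right, real_inner_self_eq_norm_sq, hv]
    ring
  have hae : a e = p e := if_pos (by linarith)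
  have hbe : b e = q e := if_pos (by linarith)
  have hperp_e : perp v (q e) = perp v (p e) := by
    rw [← sub_eq_zero, ← perp_sub, hve, perp, inner_smul_right, real_inner_self_eq_norm_sq, hv]
    simp
  have hperp_me : perp v (m e) = perp v (p e) := by
    simp only [hm, midpoint_eq_smul_add, invOf_eq_inv, perp] at hperp_e ⊢
    rw [inner_smul_right, inner_add_right]
    have : q e = p e - (inner ℝ v (p e) : ℝ) • v + (inner ℝ v (q e) : ℝ) • v := by
      rw [← hperp_e]; abel
    rw [this]
    simp only [inner_add_right, inner_sub_right, inner_smul_right, real_inner_self_eq_norm_sq, hv]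
    module
  have hte : t e - inner ℝ v (p e) = L / 2 := by
    rw [htm e, hae, hbe]
    linarith
  have hnear_t : ∀ i ∈ s, |t i - t e| ≤ ε * (δ i + L) := fun i hi => by
    rw [ht, ← inner_sub_right]
    refine (abs_inner_le hv _).trans ?_
    rw [← dist_eq_norm]
    exact hnear i hi
  have hεL : ε * L ≤ L / 8 := by nlinarith
  have hye : ∀ i ∈ s, ‖perp v (p e) - y‖ ≤ 3 * (ε * L) := fun i hi => by
    have h1 := norm_sub_le_norm_sub_add_norm_sub (perp v (p e)) (perp v (m i)) y
    have h2 : ‖perp v (p e) - perp v (m i)‖ ≤ ε * (δ i + L) := by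
      rw [← hperp_me, norm_sub_rev, ← perp_sub]
      refine (norm_perp_le hv _).trans ?_
      rw [← dist_eq_norm]
      exact hnear i hi
    have h3 : ε * δ i ≤ ε * (L / 16) := mul_le_mul_of_nonneg_left (hsmall i hi) hε.le
    nlinarith [hy i hi]
  have hpos : ∀ i ∈ s, |t i - t e| ≤ L / 4 := fun i hi => by
    have h3 : ε * δ i ≤ ε * (L / 16) := mul_le_mul_of_nonneg_left (hsmall i hi) hε.le
    nlinarith [hnear_t i hi]
  -- The cost of bending from an end of `e` to the line: `h ^ 2 ≤ 18 * ε ^ 2 * L ^ 2 + 2 * δ i ^ 2`.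
  -- With `D ≥ L / 4` the first term gives `κ = 36 * ε ^ 2 * L`, and the second is absorbed by `δ i
  -- / 4` since `δ i ≤ L / 16`.
  have hbend : ∀ i ∈ s, ∀ D, L / 4 ≤ D →
      (3 * (ε * L) + δ i) ^ 2 ≤ 2 * D * (36 * ε ^ 2 * L + δ i / 4) := fun i hi D hD => by
    have h1 : 2 * (L / 4) * (36 * ε ^ 2 * L + δ i / 4) ≤ 2 * D * (36 * ε ^ 2 * L + δ i / 4) := by
      have := hδ0 i
      gcongr
    have h2 : δ i * δ i ≤ L / 16 * δ i := mul_le_mul_of_nonneg_right (hsmall i hi) (hδ0 i)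
    nlinarith [sq_nonneg (3 * (ε * L) - δ i)]
  -- a subfamily that is well separated along the line
  obtain ⟨G, hGs, hGfree, hGdom⟩ := exists_greedy s δ (fun i j => |t i - t j| < 2 * (δ i + δ j))
    fun i j hij => by rwa [abs_sub_comm, add_comm]
  have hG : ∑ i ∈ G, δ i ≤ 144 * ε ^ 2 * L := by
    have := h.sum_le_of_chain a b hab e G
      (fun heG => by have := hsmall e (hGs heG); linarith) t (inner ℝ v (p e)) (inner ℝ v (q e))
      (36 * ε ^ 2 * L) (by positivity) (by rw [hdab, hinner_e]) ?_ ?_ ?_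
    · simp only [hdab] at this
      linarith
    · intro i hi k hk hik htik
      have h1 := hGfree i hi k hk hik
      rw [not_lt, abs_sub_comm, abs_of_nonneg (by linarith)] at h1
      rw [hdab, hdab, dist_comm, dist_eq_norm]
      -- The gap `D ≥ 2 * (δ i + δ k)` makes `h ^ 2 / (2 * D)` at most `(δ i + δ k) / 4`, exactly
      -- the allowance of the chain lemma.
      refine norm_le_add_of_sq hv (D := t k - t i) (h := δ i + δ k) ?_ ?_
        (by linarith [hδ0 i, hδ0 k]) ?_
      · rw [inner_sub_right, abs_le]
        constructor <;> linarith [hta k, htb i, hδ0 i, hδ0 k]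
      · rw [perp_sub, ← sub_sub_sub_cancel_right _ _ y]
        linarith [norm_sub_le (perp v (a k) - y) (perp v (b i) - y), hpay k (hGs hk),
          hpby i (hGs hi)]
      · nlinarith [hδ0 i, hδ0 k]
    · intro i hi
      have h0 := abs_le.1 (hpos i (hGs hi))
      have h1 := hsmall i (hGs hi)
      rw [hdab, hae, dist_comm, dist_eq_norm, add_assoc]
      refine norm_le_add_of_sq hv (h := 3 * (ε * L) + δ i) ?_ ?_
        (by have := hδ0 i; positivity) (hbend i (hGs hi) _ (by linarith))
      · rw [inner_sub_right, abs_le]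
        constructor <;> linarith [hta i, hδ0 i]
      · rw [perp_sub, ← sub_sub_sub_cancel_right _ _ y]
        linarith [norm_sub_le (perp v (a i) - y) (perp v (p e) - y), hpay i (hGs hi),
          hye i (hGs hi)]
    · intro i hi
      have h0 := abs_le.1 (hpos i (hGs hi))
      have h1 := hsmall i (hGs hi)
      rw [hdab, hbe, dist_comm, dist_eq_norm, add_assoc]
      refine norm_le_add_of_sq hv (h := 3 * (ε * L) + δ i) ?_ ?_
        (by have := hδ0 i; positivity) (hbend i (hGs hi) _ (by linarith))
      · rw [inner_sub_right, abs_le]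
        constructor <;> linarith [htb i, hδ0 i]
      · rw [perp_sub, hperp_e, ← sub_sub_sub_cancel_right _ _ y]
        linarith [norm_sub_le (perp v (p e) - y) (perp v (b i) - y), hpby i (hGs hi),
          hye i (hGs hi)]
  -- Edges lost to the spacing condition sit within `4 * δ g` of a kept edge `g`. Their disjoint
  -- intervals of radius `ε * δ i / 2` fit in radius `5 * δ g`, which gives the factor `10 / ε`.
  calc ∑ i ∈ s, δ i ≤ ∑ g ∈ G, 10 / ε * δ g := by
        refine sum_le_sum_of_charge s G δ _ (fun g i => δ i ≤ δ g ∧ |t i - t g| ≤ 4 * δ g)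
          (fun i _ => hδ0 i) (fun i hi => ?_) fun g hg => ?_
        · obtain ⟨g, hg, hle, rfl | hc⟩ := hGdom i hi
          · exact ⟨i, hg, le_rfl, by simpa using hδ0 i⟩
          · exact ⟨g, hg, hle, by linarith⟩
        · have hsub : ∀ i ∈ s.filter (fun i => δ i ≤ δ g ∧ |t i - t g| ≤ 4 * δ g), i ∈ s :=
            fun i hi => (Finset.mem_filter.1 hi).1
          have := MinCostMatching.sum_le_of_near_line hv
            (s.filter fun i => δ i ≤ δ g ∧ |t i - t g| ≤ 4 * δ g) m (fun i => ε * δ i / 2)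
            (fun i _ => by have := hδ0 i; positivity)
            (fun i hi j hj hij => by
              have := hsep i (hsub i hi) j (hsub j hj) hij
              simp only [hδ, hm]
              linarith) y (fun i hi => hy i (hsub i hi)) (t g) (5 * δ g)
            (by linarith [hδ0 g]) (fun i hi => by
              have h1 := (Finset.mem_filter.1 hi).2
              simp only [ht] at h1
              linarith [hεδ i, hδ0 i])
          rw [← Finset.sum_div, ← Finset.mul_sum] at this
          rw [div_mul_eq_mul_div, le_div_iff₀ hε]
          linarith
    _ = 10 / ε * ∑ g ∈ G, δ g := (Finset.mul_sum _ _ _).symm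
    _ ≤ 10 / ε * (144 * ε ^ 2 * L) := by gcongr
    _ = 1440 * ε * L := by field_simp; norm_num

end LineBounds

/-! ### Domination between edges. -/

section Dominated

variable {E ι : Type*} [NormedAddCommGroup E] [InnerProductSpace ℝ E]

open Classical in
/-- The edges dominated by `e`: those that are not longer and whose balls meet that of `e`. -/
noncomputable def dominated (ε : ℝ) (p q : ι → E) (s : Finset ι) (e : ι) : Finset ι :=
  s.filter fun i => dist (p i) (q i) ≤ dist (p e) (q e) ∧
    dist (midpoint ℝ (p i) (q i)) (midpoint ℝ (p e) (q e))
      ≤ ε * (dist (p i) (q i) + dist (p e) (q e))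

/-- Greedy choice of edges with disjoint balls such that all others are dominated. -/
theorem exists_separated_dominating {ε : ℝ} (hε : 0 ≤ ε) (p q : ι → E) (s : Finset ι) :
    ∃ G ⊆ s, (∀ i ∈ G, ∀ j ∈ G, i ≠ j → ε * (dist (p i) (q i) + dist (p j) (q j))
      < dist (midpoint ℝ (p i) (q i)) (midpoint ℝ (p j) (q j))) ∧
      ∀ i ∈ s, ∃ g ∈ G, i ∈ dominated ε p q s g := by
  obtain ⟨G, hGs, hfree, hdom⟩ := exists_greedy s (fun i => dist (p i) (q i))
    (fun i j => dist (midpoint ℝ (p i) (q i)) (midpoint ℝ (p j) (q j))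
      ≤ ε * (dist (p i) (q i) + dist (p j) (q j)))
    fun i j hij => by rwa [dist_comm, add_comm]
  refine ⟨G, hGs, fun i hi j hj hij => not_le.1 (hfree i hi j hj hij), fun i hi => ?_⟩
  obtain ⟨g, hg, hle, hc⟩ := hdom i hi
  refine ⟨g, hg, Finset.mem_filter.2 ⟨hi, hle, ?_⟩⟩
  rcases hc with rfl | hc
  · rw [dist_self]; positivity
  · exact hc

end Dominated

/-! ### Packing bounds in dimension `n + 1`. -/

section Packing

variable {E ι : Type*} [NormedAddCommGroup E] [InnerProductSpace ℝ E] [FiniteDimensional ℝ E]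

open Classical in
/-- Averaging over all lines in direction `v`: if each such line meets balls of total weight at most
`B`, then the weighted cross-sections of the balls add up to at most `B` times that of a cylinder
containing them. -/
theorem sum_mul_pow_le_of_lines {n : ℕ} (hn : Module.finrank ℝ E = n + 1) {v : E} (hv : ‖v‖ = 1)
    (s : Finset ι) (m : ι → E) (r δ : ι → ℝ) (x₀ : E) (B R : ℝ) (hR : 0 ≤ R)
    (hr : ∀ i ∈ s, 0 ≤ r i) (hδ : ∀ i ∈ s, 0 ≤ δ i) (hin : ∀ i ∈ s, dist (m i) x₀ + r i ≤ R)
    (hB : ∀ y, ∑ i ∈ s with ‖perp v (m i) - y‖ ≤ r i, δ i ≤ B) :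
    ∑ i ∈ s, δ i * r i ^ n ≤ B * R ^ n := by
  have hfact : Fact (Module.finrank ℝ E = n + 1) := ⟨hn⟩
  have hfr : Module.finrank ℝ (ℝ ∙ v)ᗮ = n :=
    Submodule.finrank_orthogonal_span_singleton (by rintro rfl; simp at hv)
  have := sum_mul_pow_finrank_le s (fun i => (⟨perp v (m i), perp_mem hv _⟩ : (ℝ ∙ v)ᗮ)) r δ
    ⟨perp v x₀, perp_mem hv _⟩ B R hR hr hδ
    (fun i hi => by
      refine le_trans ?_ (hin i hi)
      rw [Subtype.dist_eq, dist_eq_norm, dist_eq_norm, ← perp_sub]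
      gcongr
      exact norm_perp_le hv _)
    (fun y => by
      refine le_trans (le_of_eq ?_) (hB y)
      simp only [Subtype.dist_eq, dist_eq_norm (y : E), norm_sub_rev (y : E)])
  rwa [hfr] at this

/-- Optimal edges of comparable length in a bounded region are bounded in number. -/
theorem AltOptimal.card_le {n : ℕ} (hn : Module.finrank ℝ E = n + 1) {p q : ι → E}
    (h : AltOptimal p q) (s : Finset ι) {L : ℝ} (hL : 0 < L) (x₀ : E)
    (hlong : ∀ i ∈ s, L / 16 < dist (p i) (q i)) (hp : ∀ i ∈ s, dist (p i) x₀ ≤ L)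
    (hq : ∀ i ∈ s, dist (q i) x₀ ≤ L) : (s.card : ℝ) ≤ 64 ^ (2 * (n + 1)) := by
  have hfr : Module.finrank ℝ (E × E) = 2 * (n + 1) := by
    rw [Module.finrank_prod, hn]; ring
  -- View an edge as a point of `E × E` with the max metric: if two were within `L / 16`, swapping
  -- their partners would shorten the matching. Balls of radius `L / 32` are therefore disjoint
  -- inside one of radius `2 * L`, which gives the base 64.
  have := sum_pow_finrank_le_of_separated s (fun i => (p i, q i)) (fun _ => L / 32) (x₀, x₀) (2 * L)
    (by positivity) (fun _ _ => by positivity)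
    (fun i hi => by
      have : dist (p i, q i) (x₀, x₀) ≤ L := max_le (hp i hi) (hq i hi)
      linarith)
    (fun i hi j hj hij => by
      have h1 := h.dist_add_dist_le hij
      have h2 : dist (p i) (p j) ≤ dist (p i, q i) (p j, q j) := le_max_left _ _
      have h3 : dist (q i) (q j) ≤ dist (p i, q i) (p j, q j) := le_max_right _ _
      linarith [hlong i hi, hlong j hj])
  rw [Finset.sum_const, nsmul_eq_mul, hfr, ← le_div_iff₀ (by positivity), ← div_pow] at this
  refine this.trans (le_of_eq ?_)
  congr 1
  field_simp
  norm_num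

/-- The ratio of the radius of the ball around the midpoint of an edge to its length. -/
noncomputable def ballRatio (n : ℕ) : ℝ := 1 / (2880 * 6 ^ n)

theorem ballRatio_pos (n : ℕ) : 0 < ballRatio n := by
  unfold ballRatio; positivity

theorem ballRatio_le (n : ℕ) : ballRatio n ≤ 1 / 8 := by
  unfold ballRatio
  have : (1 : ℝ) ≤ 6 ^ n := one_le_pow₀ (by norm_num)
  exact one_div_le_one_div_of_le (by norm_num) (by linarith)

/-- Short edges near the midpoint of a long one with disjoint balls have at most half of its
`d`-dimensional size. -/
theorem AltOptimal.sum_pow_le_half {n : ℕ} (hn : Module.finrank ℝ E = n + 1) {p q : ι → E}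
    (h : AltOptimal p q) (e : ι) (s : Finset ι)
    (hsep : ∀ i ∈ s, ∀ j ∈ s, i ≠ j → ballRatio n * (dist (p i) (q i) + dist (p j) (q j))
      < dist (midpoint ℝ (p i) (q i)) (midpoint ℝ (p j) (q j)))
    (hsmall : ∀ i ∈ s, dist (p i) (q i) ≤ dist (p e) (q e) / 16)
    (hnear : ∀ i ∈ s, dist (midpoint ℝ (p i) (q i)) (midpoint ℝ (p e) (q e))
      ≤ ballRatio n * (dist (p i) (q i) + dist (p e) (q e))) :
    ∑ i ∈ s, dist (p i) (q i) ^ (n + 1) ≤ dist (p e) (q e) ^ (n + 1) / 2 := by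
  classical
  set ε := ballRatio n with hεdef
  have hε : 0 < ε := ballRatio_pos n
  have hε8 : ε ≤ 1 / 8 := ballRatio_le n
  set L := dist (p e) (q e) with hLdef
  have hL0 : 0 ≤ L := dist_nonneg
  rcases hL0.eq_or_lt with hL | hL
  · rw [← hL] at hsmall ⊢
    refine (Finset.sum_eq_zero fun i hi => ?_).le.trans (by simp)
    rw [le_antisymm (by linarith [hsmall i hi]) (dist_nonneg (x := p i) (y := q i))]
    simp
  set v := L⁻¹ • (q e - p e) with hv_def
  have hv : ‖v‖ = 1 := by
    rw [hv_def, norm_smul, ← dist_eq_norm, dist_comm (q e), ← hLdef, norm_inv, Real.norm_eq_abs,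
      abs_of_pos hL, inv_mul_cancel₀ hL.ne']
  have hve : q e - p e = L • v := by rw [hv_def, smul_inv_smul₀ hL.ne']
  have hsm : ∀ i ∈ s, ε * dist (p i) (q i) ≤ ε * (L / 16) := fun i hi =>
    mul_le_mul_of_nonneg_left (hsmall i hi) hε.le
  have key := sum_mul_pow_le_of_lines hn hv s (fun i => midpoint ℝ (p i) (q i))
    (fun i => ε * dist (p i) (q i) / 2) (fun i => dist (p i) (q i)) (midpoint ℝ (p e) (q e))
    (1440 * ε * L) (3 * ε * L) (by positivity) (fun i _ => by positivity)
    (fun i _ => dist_nonneg)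
    (fun i hi => by
      have : 0 < ε * L := by positivity
      linarith [hnear i hi, hsm i hi])
    (fun y => by
      refine h.sum_le_of_near_line hε hε8 e hL hv hve _ (fun i hi j hj => ?_) (fun i hi => ?_)
        (fun i hi => ?_) y fun i hi => (Finset.mem_filter.1 hi).2
      · exact hsep i (Finset.mem_filter.1 hi).1 j (Finset.mem_filter.1 hj).1
      · exact hsmall i (Finset.mem_filter.1 hi).1
      · exact hnear i (Finset.mem_filter.1 hi).1)
  have h1 : ∑ i ∈ s, dist (p i) (q i) * (ε * dist (p i) (q i) / 2) ^ n
      = (ε / 2) ^ n * ∑ i ∈ s, dist (p i) (q i) ^ (n + 1) := by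
    rw [Finset.mul_sum]
    refine Finset.sum_congr rfl fun i _ => ?_
    rw [mul_div_right_comm, mul_pow]
    ring
  have h2 : 1440 * ε * L * (3 * ε * L) ^ n = (ε / 2) ^ n * (L ^ (n + 1) / 2) := by
    -- The value of `ballRatio` is chosen for this: the cylinder radius `3 * ε * L` is `6 * L` times
    -- the half ball ratio `ε / 2`, so the bound on the sum is `1440 * ε * 6 ^ n * L ^ (n + 1)`,
    -- exactly half of `L ^ (n + 1)`.
    have h3 : 2880 * ε * 6 ^ n = 1 := by
      rw [hεdef, ballRatio]; field_simp
    have h4 : (3 * ε * L) ^ n = 6 ^ n * (ε / 2) ^ n * L ^ n := by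
      rw [← mul_pow, ← mul_pow]; congr 1; ring
    rw [h4]
    linear_combination ((ε / 2) ^ n * L ^ (n + 1) / 2) * h3
  rw [h1, h2] at key
  exact le_of_mul_le_mul_left key (by positivity)

/-- The edges dominated by `e` have total `d`-dimensional size at most a constant times that of
`e`. -/
theorem AltOptimal.sum_dominated_le {n : ℕ} (hn : Module.finrank ℝ E = n + 1) {p q : ι → E}
    (h : AltOptimal p q) (s : Finset ι) (e : ι) :
    ∑ i ∈ dominated (ballRatio n) p q s e, dist (p i) (q i) ^ (n + 1)
      ≤ 2 * 64 ^ (2 * (n + 1)) * dist (p e) (q e) ^ (n + 1) := by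
  classical
  set ε := ballRatio n with hεdef
  have hε : 0 < ε := ballRatio_pos n
  have hε8 : ε ≤ 1 / 8 := ballRatio_le n
  set δ : ι → ℝ := fun i => dist (p i) (q i) with hδ
  have hδ0 : ∀ i, 0 ≤ δ i := fun i => dist_nonneg
  -- Induction on the number of edges shorter than `e`. With `A` bounding the number of long
  -- dominated edges, those contribute at most `A * δ e ^ (n + 1)`. The short ones contribute `2 *
  -- A` times a sum of at most `δ e ^ (n + 1) / 2`, so the constant `2 * A` reproduces itself.
  induction hk : (s.filter fun i => δ i < δ e).card using Nat.strong_induction_on generalizing e with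
  | _ k ih =>
  set A : ℝ := 64 ^ (2 * (n + 1)) with hA
  have hA0 : 0 < A := by positivity
  set D := dominated ε p q s e with hD
  have hDs : ∀ i ∈ D, i ∈ s ∧ δ i ≤ δ e ∧
      dist (midpoint ℝ (p i) (q i)) (midpoint ℝ (p e) (q e)) ≤ ε * (δ i + δ e) := fun i hi =>
    Finset.mem_filter.1 hi
  rcases (hδ0 e).eq_or_lt with he | he
  · refine (Finset.sum_eq_zero fun i hi => ?_).le.trans (by positivity)
    have : δ i = 0 := le_antisymm (he ▸ (hDs i hi).2.1) (hδ0 i)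
    simp only [hδ] at this
    rw [this, zero_pow n.succ_ne_zero]
  set D₁ := D.filter fun i => δ i ≤ δ e / 16 with hD₁
  have hD₁s : ∀ i ∈ D₁, i ∈ D ∧ δ i ≤ δ e / 16 := fun i hi => Finset.mem_filter.1 hi
  obtain ⟨G, hG, hGsep, hGdom⟩ := exists_separated_dominating hε.le p q D₁
  have hshort : ∑ i ∈ D₁, δ i ^ (n + 1) ≤ A * δ e ^ (n + 1) := by
    calc ∑ i ∈ D₁, δ i ^ (n + 1) ≤ ∑ g ∈ G, 2 * A * δ g ^ (n + 1) := by
          refine sum_le_sum_of_charge D₁ G _ _ (fun g i => i ∈ dominated ε p q D₁ g)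
            (fun i _ => pow_nonneg (hδ0 i) _) hGdom fun g hg => ?_
          have hgD := hD₁s g (hG hg)
          have hlt : δ g < δ e := by linarith [hgD.2]
          refine le_trans ?_ (ih _ ?_ g rfl)
          · refine Finset.sum_le_sum_of_subset_of_nonneg (fun i hi => ?_)
              fun i _ _ => pow_nonneg (hδ0 i) _
            have h1 := Finset.mem_filter.1 (Finset.mem_filter.1 hi).2
            exact Finset.mem_filter.2 ⟨(hDs i (hD₁s i h1.1).1).1, h1.2⟩
          · rw [← hk]
            refine Finset.card_lt_card (Finset.ssubset_iff_of_subset ?_ |>.2 ⟨g, ?_, ?_⟩)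
            · intro i hi
              rw [Finset.mem_filter] at hi ⊢
              exact ⟨hi.1, hi.2.trans hlt⟩
            · exact Finset.mem_filter.2 ⟨(hDs g hgD.1).1, hlt⟩
            · simp
      _ = 2 * A * ∑ g ∈ G, δ g ^ (n + 1) := (Finset.mul_sum _ _ _).symm
      _ ≤ 2 * A * (δ e ^ (n + 1) / 2) := by
          gcongr
          exact h.sum_pow_le_half hn e G hGsep (fun g hg => (hD₁s g (hG hg)).2)
            fun g hg => (hDs g (hD₁s g (hG hg)).1).2.2
      _ = A * δ e ^ (n + 1) := by ring
  have hlong : ∑ i ∈ D with ¬ δ i ≤ δ e / 16, δ i ^ (n + 1) ≤ A * δ e ^ (n + 1) := by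
    set D₂ := D.filter fun i => ¬ δ i ≤ δ e / 16
    have hD₂s : ∀ i ∈ D₂, i ∈ D ∧ ¬ δ i ≤ δ e / 16 := fun i hi => Finset.mem_filter.1 hi
    have hmid : ∀ i ∈ D₂, dist (midpoint ℝ (p i) (q i)) (midpoint ℝ (p e) (q e)) ≤ δ e / 4 :=
      fun i hi => by
        have h1 := hDs i (hD₂s i hi).1
        nlinarith [hδ0 i]
    have hcard : (D₂.card : ℝ) ≤ A := by
      refine h.card_le hn D₂ he (midpoint ℝ (p e) (q e)) (fun i hi => not_le.1 (hD₂s i hi).2)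
        (fun i hi => ?_) fun i hi => ?_
      · have h1 := dist_triangle (p i) (midpoint ℝ (p i) (q i)) (midpoint ℝ (p e) (q e))
        have h2 : dist (p i) (midpoint ℝ (p i) (q i)) = δ i / 2 := by
          rw [dist_left_midpoint]; norm_num; ring
        linarith [hmid i hi, (hDs i (hD₂s i hi).1).2.1]
      · have h1 := dist_triangle (q i) (midpoint ℝ (p i) (q i)) (midpoint ℝ (p e) (q e))
        have h2 : dist (q i) (midpoint ℝ (p i) (q i)) = δ i / 2 := by
          rw [dist_right_midpoint]; norm_num; ring
        linarith [hmid i hi, (hDs i (hD₂s i hi).1).2.1]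
    calc ∑ i ∈ D₂, δ i ^ (n + 1) ≤ ∑ _i ∈ D₂, δ e ^ (n + 1) :=
          Finset.sum_le_sum fun i hi => pow_le_pow_left₀ (hδ0 i) (hDs i (hD₂s i hi).1).2.1 _
      _ = D₂.card * δ e ^ (n + 1) := by rw [Finset.sum_const, nsmul_eq_mul]
      _ ≤ A * δ e ^ (n + 1) := by gcongr
  have := Finset.sum_filter_add_sum_filter_not D (fun i => δ i ≤ δ e / 16) fun i => δ i ^ (n + 1)
  change ∑ i ∈ D, δ i ^ (n + 1) ≤ 2 * A * δ e ^ (n + 1)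
  linarith

/-- Optimal edges whose midpoints lie in a slab of half-width `W` and in a ball of radius `R` have
total `d`-dimensional size `O(R ^ (d - 1) * W)`. -/
theorem AltOptimal.sum_pow_le_of_slab {n : ℕ} (hn : Module.finrank ℝ E = n + 1) {p q : ι → E}
    (h : AltOptimal p q) (s : Finset ι) {u : E} (hu : ‖u‖ = 1) (c : ℝ) (x₀ : E) {W R : ℝ}
    (hW : 0 ≤ W) (hR : 0 ≤ R)
    (hslab : ∀ i ∈ s, |inner ℝ u (midpoint ℝ (p i) (q i)) - c| + dist (p i) (q i) ≤ W)
    (hball : ∀ i ∈ s, dist (midpoint ℝ (p i) (q i)) x₀ + dist (p i) (q i) ≤ R) :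
    ∑ i ∈ s, dist (p i) (q i) ^ (n + 1)
      ≤ 2 * 64 ^ (2 * (n + 1)) * (2 / ballRatio n) ^ (n + 1) * R ^ n * W := by
  classical
  set ε := ballRatio n with hεdef
  have hε : 0 < ε := ballRatio_pos n
  have hε8 : ε ≤ 1 / 8 := ballRatio_le n
  set δ : ι → ℝ := fun i => dist (p i) (q i) with hδ
  have hδ0 : ∀ i, 0 ≤ δ i := fun i => dist_nonneg
  have hεδ : ∀ i, ε * δ i / 2 ≤ δ i := fun i => by nlinarith [hδ0 i]
  obtain ⟨G, hG, hGsep, hGdom⟩ := exists_separated_dominating hε.le p q s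
  -- Lines in the thin direction `u` meet the slab in a length of order `W`, and their parameter
  -- space is a cross-section of size `R ^ n`.
  have key := sum_mul_pow_le_of_lines hn hu G (fun i => midpoint ℝ (p i) (q i))
    (fun i => ε * δ i / 2) δ x₀ (2 / ε * W) R hR (fun i _ => by have := hδ0 i; positivity)
    (fun i _ => hδ0 i) (fun i hi => by linarith [hball i (hG hi), hεδ i])
    (fun y => by
      have hsub : ∀ i ∈ G.filter
          (fun i => ‖perp u (midpoint ℝ (p i) (q i)) - y‖ ≤ ε * δ i / 2), i ∈ G :=
        fun i hi => (Finset.mem_filter.1 hi).1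
      have := MinCostMatching.sum_le_of_near_line hu
        (G.filter fun i => ‖perp u (midpoint ℝ (p i) (q i)) - y‖ ≤ ε * δ i / 2)
        (fun i => midpoint ℝ (p i) (q i)) (fun i => ε * δ i / 2)
        (fun i _ => by have := hδ0 i; positivity)
        (fun i hi j hj hij => by
          have := hGsep i (hsub i hi) j (hsub j hj) hij
          simp only [hδ]
          linarith) y (fun i hi => (Finset.mem_filter.1 hi).2) c W hW
        (fun i hi => by linarith [hslab i (hG (hsub i hi)), hεδ i])
      rw [← Finset.sum_div, ← Finset.mul_sum] at this
      rw [div_mul_eq_mul_div, le_div_iff₀ hε]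
      linarith)
  have h1 : ∑ i ∈ G, δ i * (ε * δ i / 2) ^ n = (ε / 2) ^ n * ∑ i ∈ G, δ i ^ (n + 1) := by
    rw [Finset.mul_sum]
    refine Finset.sum_congr rfl fun i _ => ?_
    rw [mul_div_right_comm, mul_pow]
    ring
  rw [h1] at key
  have hGsum : ∑ i ∈ G, δ i ^ (n + 1) ≤ (2 / ε) ^ (n + 1) * R ^ n * W := by
    refine le_of_mul_le_mul_left (key.trans (le_of_eq ?_)) (by positivity : 0 < (ε / 2) ^ n)
    have : (ε / 2) ^ n * (2 / ε) ^ n = 1 := by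
      rw [← mul_pow, div_mul_div_comm, mul_comm ε, div_self (by positivity), one_pow]
    rw [pow_succ]
    linear_combination (-(2 / ε) * R ^ n * W) * this
  calc ∑ i ∈ s, δ i ^ (n + 1)
      ≤ ∑ g ∈ G, 2 * 64 ^ (2 * (n + 1)) * δ g ^ (n + 1) := by
        refine sum_le_sum_of_charge s G _ _ (fun g i => i ∈ dominated ε p q s g)
          (fun i _ => pow_nonneg (hδ0 i) _) hGdom fun g _ => ?_
        refine le_trans (Finset.sum_le_sum_of_subset_of_nonneg (fun i hi => ?_)
          fun i _ _ => pow_nonneg (hδ0 i) _) (h.sum_dominated_le hn s g)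
        exact (Finset.mem_filter.1 hi).2
    _ = 2 * 64 ^ (2 * (n + 1)) * ∑ g ∈ G, δ g ^ (n + 1) := (Finset.mul_sum _ _ _).symm
    _ ≤ 2 * 64 ^ (2 * (n + 1)) * ((2 / ε) ^ (n + 1) * R ^ n * W) := by gcongr
    _ = _ := by ring

end Packing

/-! ### From min-cost matchings to alternating optimality. -/

section Matching

variable {d : ℕ} {P : Finset (Pt d)} {M : Finset (Sym2 (Pt d))}

theorem IsMatching.eq_of_mem (h : IsMatching P M) {e f : Sym2 (Pt d)} (he : e ∈ M) (hf : f ∈ M)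
    {x : Pt d} (hxe : x ∈ e) (hxf : x ∈ f) : e = f :=
  (h.existsUnique x (h.mem_of_mem e he x hxe)).unique ⟨he, hxe⟩ ⟨hf, hxf⟩

/-- Exchanging the partners in two edges of a matching. -/
theorem IsMatching.swap [DecidableEq (Sym2 (Pt d))] (h : IsMatching P M) {p q a b : Pt d}
    (hpq : s(p, q) ∈ M) (hab : s(a, b) ∈ M) (hne : s(a, b) ≠ s(p, q)) :
    IsMatching P (insert s(p, a) (insert s(b, q) ((M.erase s(p, q)).erase s(a, b)))) ∧
    cost (insert s(p, a) (insert s(b, q) ((M.erase s(p, q)).erase s(a, b))))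
      = cost M - dist p q + dist p a - dist a b + dist b q := by
  have hdpq : p ≠ q := fun e => h.not_isDiag _ hpq (by simpa using e)
  have hdab : a ≠ b := fun e => h.not_isDiag _ hab (by simpa using e)
  have hpa : p ≠ a := fun e => hne (h.eq_of_mem hab hpq (x := p) (by simp [e]) (by simp))
  have hpb : p ≠ b := fun e => hne (h.eq_of_mem hab hpq (x := p) (by simp [e]) (by simp))
  have hqa : q ≠ a := fun e => hne (h.eq_of_mem hab hpq (x := q) (by simp [e]) (by simp))
  have hqb : q ≠ b := fun e => hne (h.eq_of_mem hab hpq (x := q) (by simp [e]) (by simp))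
  set N := (M.erase s(p, q)).erase s(a, b) with hN
  have hNM : ∀ e ∈ N, e ∈ M ∧ e ≠ s(p, q) ∧ e ≠ s(a, b) := fun e he => by
    simp only [hN, Finset.mem_erase] at he
    exact ⟨he.2.2, he.2.1, he.1⟩
  have hNp : ∀ e ∈ N, p ∉ e := fun e he hx =>
    (hNM e he).2.1 (h.eq_of_mem (hNM e he).1 hpq hx (by simp))
  have hNq : ∀ e ∈ N, q ∉ e := fun e he hx =>
    (hNM e he).2.1 (h.eq_of_mem (hNM e he).1 hpq hx (by simp))
  have hNa : ∀ e ∈ N, a ∉ e := fun e he hx =>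
    (hNM e he).2.2 (h.eq_of_mem (hNM e he).1 hab hx (by simp))
  have hNb : ∀ e ∈ N, b ∉ e := fun e he hx =>
    (hNM e he).2.2 (h.eq_of_mem (hNM e he).1 hab hx (by simp))
  have hP : ∀ {e}, e ∈ M → ∀ x ∈ e, x ∈ P := fun he x hx => h.mem_of_mem _ he x hx
  refine ⟨⟨?_, ?_, ?_⟩, ?_⟩
  · simp only [Finset.mem_insert]
    rintro e (rfl | rfl | he)
    · simpa using hpa
    · simpa using hqb.symm
    · exact h.not_isDiag e (hNM e he).1
  · simp only [Finset.mem_insert]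
    rintro e (rfl | rfl | he) x hx
    · rcases Sym2.mem_iff.1 hx with rfl | rfl
      exacts [hP hpq _ (by simp), hP hab _ (by simp)]
    · rcases Sym2.mem_iff.1 hx with rfl | rfl
      exacts [hP hab _ (by simp), hP hpq _ (by simp)]
    · exact hP (hNM e he).1 x hx
  · intro x hx
    simp only [Finset.mem_insert]
    by_cases h1 : x = p ∨ x = a
    · refine ⟨s(p, a), ⟨Or.inl rfl, by simpa using h1⟩, ?_⟩
      rintro e ⟨rfl | rfl | he, hxe⟩
      · rfl
      · rcases Sym2.mem_iff.1 hxe with rfl | rfl <;> rcases h1 with rfl | rfl <;> simp_all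
      · rcases h1 with rfl | rfl
        exacts [(hNp e he hxe).elim, (hNa e he hxe).elim]
    by_cases h2 : x = b ∨ x = q
    · refine ⟨s(b, q), ⟨Or.inr (Or.inl rfl), by simpa using h2⟩, ?_⟩
      rintro e ⟨rfl | rfl | he, hxe⟩
      · exact (h1 (by simpa using hxe)).elim
      · rfl
      · rcases h2 with rfl | rfl
        exacts [(hNb e he hxe).elim, (hNq e he hxe).elim]
    obtain ⟨e, ⟨heM, hxe⟩, huniq⟩ := h.existsUnique x hx
    have heN : e ∈ N := by
      simp only [hN, Finset.mem_erase]
      refine ⟨?_, ?_, heM⟩ <;> rintro rfl <;> rcases Sym2.mem_iff.1 hxe with rfl | rfl <;> simp_all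
    refine ⟨e, ⟨Or.inr (Or.inr heN), hxe⟩, ?_⟩
    rintro f ⟨rfl | rfl | hf, hxf⟩
    · exact (h1 (by simpa using hxf)).elim
    · exact (h2 (by simpa using hxf)).elim
    · exact huniq f ⟨(hNM f hf).1, hxf⟩
  · have hbq : s(b, q) ∉ N := fun he => hNb _ he (by simp)
    have hpa' : s(p, a) ∉ insert s(b, q) N := by
      rw [Finset.mem_insert]
      rintro (he | he)
      · have : p ∈ s(b, q) := he ▸ Sym2.mem_mk_left p a
        rcases Sym2.mem_iff.1 this with e | e
        exacts [hpb e, hdpq e]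
      · exact hNp _ he (by simp)
    have hab' : s(a, b) ∈ M.erase s(p, q) := Finset.mem_erase.2 ⟨hne, hab⟩
    have e1 := Finset.add_sum_erase M edgeLength hpq
    have e2 := Finset.add_sum_erase (M.erase s(p, q)) edgeLength hab'
    simp only [cost]
    rw [Finset.sum_insert hpa', Finset.sum_insert hbq]
    simp only [edgeLength, Sym2.lift_mk] at e1 e2 ⊢
    linarith

/-- An exchange along a cycle is a succession of two-edge swaps: after swapping `{x, y}` with `{a i,
b i}`, the new edge `{b i, y}` plays the role of `{x, y}` for the rest of the list. -/
theorem IsMatching.exists_altCost {ι : Type*} (a b : ι → Pt d) : ∀ (l : List ι) (x y : Pt d)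
    (M : Finset (Sym2 (Pt d))), IsMatching P M → s(x, y) ∈ M →
    (∀ i ∈ l, s(a i, b i) ∈ M ∧ s(a i, b i) ≠ s(x, y)) →
    l.Pairwise (fun i j => s(a i, b i) ≠ s(a j, b j)) →
    ∃ M', IsMatching P M' ∧ cost M' = cost M - dist x y + altCost a b x l y
  | [], x, y, M, h, _, _, _ => ⟨M, h, by simp [altCost]⟩
  | i :: l, x, y, M, h, hxy, hl, hp => by
    classical
    have hi := hl i (by simp)
    obtain ⟨h1, hc⟩ := h.swap hxy hi.1 hi.2
    rw [List.pairwise_cons] at hp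
    obtain ⟨M', hM', hc'⟩ := exists_altCost a b l (b i) y _ h1 (by simp)
      (fun j hj => by
        have hj1 := hl j (List.mem_cons_of_mem _ hj)
        have hj2 := hp.1 j hj
        refine ⟨?_, fun he => hj2 ?_⟩
        · simp only [Finset.mem_insert, Finset.mem_erase]
          exact Or.inr (Or.inr ⟨hj2.symm, hj1.2, hj1.1⟩)
        · refine h.eq_of_mem hi.1 hj1.1 (x := b i) (by simp) ?_
          rw [he]
          simp) hp.2
    refine ⟨M', hM', ?_⟩
    rw [hc', hc, altCost]
    ring

/-- The edges of a min-cost matching admit no improving alternating cycle. -/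
theorem IsMinCostMatching.altOptimal (h : IsMinCostMatching P M) {ι : Type*} (p q : ι → Pt d)
    (hM : ∀ i, s(p i, q i) ∈ M) (hinj : Function.Injective fun i => s(p i, q i)) :
    AltOptimal p q := by
  intro a b hab i l hl
  have hs : ∀ i, s(a i, b i) = s(p i, q i) := fun i => by
    rcases hab i with ⟨h1, h2⟩ | ⟨h1, h2⟩
    · rw [h1, h2]
    · rw [h1, h2, Sym2.eq_swap]
  rw [List.nodup_cons] at hl
  obtain ⟨M', hM', hc⟩ := IsMatching.exists_altCost a b l (a i) (b i) M h.1 (hs i ▸ hM i)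
    (fun j hj => by
      rw [hs, hs]
      refine ⟨hM j, fun he => hl.1 ?_⟩
      rwa [← hinj he])
    (hl.2.imp fun {i j} hij he => hij (hinj (by simpa only [hs] using he)))
  linarith [h.2 M' hM']

end Matching

/-! ### Cutting edges down to the slab. -/

section Trim

/-- The end pieces cut off an edge are exactly what its two connections need to reach the original
endpoints, so only the pieces at `x` and `y` remain unpaid. -/
theorem altCost_le_of_trim {E ι : Type*} [PseudoMetricSpace E] {a b a' b' : ι → E}
    (h : ∀ i, dist (a i) (b i) = dist (a i) (a' i) + dist (a' i) (b' i) + dist (b' i) (b i)) :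
    ∀ (l : List ι) (x x' y y' : E),
      altCost a b x l y ≤ dist x x' + altCost a' b' x' l y' + dist y' y
  | [], x, x', y, y' => by
    simp only [altCost]
    exact dist_triangle4 _ _ _ _
  | i :: l, x, x', y, y' => by
    have ih := altCost_le_of_trim h l (b i) (b' i) y y'
    have h1 := dist_triangle4 x x' (a' i) (a i)
    simp only [altCost]
    linarith [h i, dist_comm (a i) (a' i), dist_comm (b i) (b' i)]

/-- Alternating optimality is inherited by subsegments. -/
theorem AltOptimal.trim {E ι : Type*} [PseudoMetricSpace E] {p q p' q' : ι → E}
    (hopt : AltOptimal p q)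
    (h : ∀ i, dist (p i) (q i) = dist (p i) (p' i) + dist (p' i) (q' i) + dist (q' i) (q i)) :
    AltOptimal p' q' := by
  classical
  intro a' b' hab' i l hl
  have hex : ∀ i, ∃ x y, ((x = p i ∧ y = q i) ∨ (x = q i ∧ y = p i)) ∧
      dist x y = dist x (a' i) + dist (a' i) (b' i) + dist (b' i) y := fun i => by
    rcases hab' i with ⟨h1, h2⟩ | ⟨h1, h2⟩
    · exact ⟨p i, q i, Or.inl ⟨rfl, rfl⟩, by rw [h1, h2, h]⟩
    · refine ⟨q i, p i, Or.inr ⟨rfl, rfl⟩, ?_⟩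
      rw [h1, h2, dist_comm (q i) (p i), h, dist_comm (q i), dist_comm (q' i) (p' i),
        dist_comm (p' i) (p i)]
      ring
  choose a b hab hd using hex
  have h1 := hopt a b hab i l hl
  have h2 := altCost_le_of_trim hd l (a i) (a' i) (b i) (b' i)
  linarith [hd i]

variable {d : ℕ}

theorem clipPoint_spec {O : Set (Pt d)} (hO : IsClosed O) {p q : Pt d}
    (hne : (segment ℝ p q ∩ O).Nonempty) :
    clipPoint O p q ∈ segment ℝ p q ∩ O ∧
      ∀ y ∈ segment ℝ p q ∩ O, dist p (clipPoint O p q) ≤ dist p y := by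
  have hc : IsCompact (segment ℝ p q ∩ O) := by
    refine IsCompact.inter_right ?_ hO
    rw [segment_eq_image_lineMap]
    exact isCompact_Icc.image AffineMap.lineMap_continuous
  have hex : ∃ x ∈ segment ℝ p q ∩ O, ∀ y ∈ segment ℝ p q ∩ O, dist p x ≤ dist p y :=
    hc.exists_isMinOn hne (continuous_const.dist continuous_id).continuousOn
  rw [clipPoint, dif_pos hex]
  exact hex.choose_spec

/-- An edge meeting a closed set contains a subsegment that starts in this set and whose length is
the truncated clipped length. -/
theorem exists_trim {O : Set (Pt d)} (hO : IsClosed O) {p q : Pt d}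
    (hne : (segment ℝ p q ∩ O).Nonempty) {W : ℝ} (hW : 0 < W) :
    ∃ p' q', p' ∈ O ∧ dist p q = dist p p' + dist p' q' + dist q' q ∧
      dist p' q' = min W (clippedLength O s(p, q)) := by
  have hclip : clippedLength O s(p, q) = dist (clipPoint O p q) (clipPoint O q p) := by
    simp only [clippedLength, Sym2.lift_mk, if_pos hne]
  obtain ⟨h0, hmin⟩ := clipPoint_spec hO hne
  obtain ⟨h1, -⟩ := clipPoint_spec hO (p := q) (q := p) (by rwa [segment_symm])
  rw [segment_symm] at h1
  have hle := hmin _ h1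
  set x₀ := clipPoint O p q
  set x₁ := clipPoint O q p
  have h01 := h0.1
  have h11 := h1.1
  rw [segment_eq_image_lineMap] at h01 h11
  obtain ⟨s, ⟨hs0, hs1⟩, hs⟩ := h01
  obtain ⟨t, ⟨ht0, ht1⟩, ht⟩ := h11
  set D := dist p q with hD
  have hD0 : 0 ≤ D := dist_nonneg
  have hdist : ∀ a b : ℝ, a ≤ b →
      dist (AffineMap.lineMap p q a : Pt d) (AffineMap.lineMap p q b) = (b - a) * D :=
    fun a b hab => by
      rw [dist_lineMap_lineMap, Real.dist_eq, abs_sub_comm, abs_of_nonneg (by linarith)]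
  have hdp : ∀ a : ℝ, 0 ≤ a → dist p (AffineMap.lineMap p q a : Pt d) = a * D := fun a ha => by
    simpa using hdist 0 a ha
  have hdq : ∀ a : ℝ, a ≤ 1 → dist (AffineMap.lineMap p q a : Pt d) q = (1 - a) * D :=
    fun a ha => by simpa using hdist a 1 ha
  rw [← hs, ← ht, hdp s hs0, hdp t ht0] at hle
  have hx : dist x₀ x₁ = (t - s) * D := by
    rcases le_total s t with hst | hst
    · rw [← hs, ← ht, hdist s t hst]
    · rw [← hs, ← ht, dist_comm, hdist t s hst]
      nlinarith
  -- Start at the first clip point and move towards `q` for the truncated length. When `p = q`, the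
  -- parameters `s` and `t` need not be ordered, but all lengths vanish.
  obtain ⟨r, hsr, hr1, hr⟩ : ∃ r, s ≤ r ∧ r ≤ 1 ∧ (r - s) * D = min W ((t - s) * D) := by
    rcases hD0.eq_or_lt with h | h
    · exact ⟨s, le_rfl, hs1, by rw [← h]; simp [hW.le]⟩
    · have hst : s ≤ t := le_of_mul_le_mul_right hle h
      rcases le_total W ((t - s) * D) with hw | hw
      · refine ⟨s + W / D, by linarith [div_pos hW h], ?_, ?_⟩
        · have : W / D ≤ t - s := (div_le_iff₀ h).2 hw
          linarith
        · rw [min_eq_left hw, add_sub_cancel_left, div_mul_cancel₀ _ h.ne']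
      · exact ⟨t, hst, ht1, (min_eq_right hw).symm⟩
  refine ⟨x₀, AffineMap.lineMap p q r, h0.2, ?_, ?_⟩
  · rw [← hs, hdp s hs0, hdist s r hsr, hdq r hr1]
    ring
  · rw [hclip, hx, ← hr, ← hs, hdist s r hsr]

theorem isClosed_cube (b : OrthonormalBasis (Fin d) ℝ (Pt d)) (a : Pt d) (l : ℝ) :
    IsClosed (cube b a l) := by
  simp only [cube, Set.ofPred_forall, Set.ofPred_and]
  refine isClosed_iInter fun i => IsClosed.inter ?_ ?_
  · exact isClosed_le continuous_const (by fun_prop)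
  · exact isClosed_le (by fun_prop) continuous_const

theorem isClosed_slab (u : Pt d) (c w : ℝ) : IsClosed (slab u c w) :=
  isClosed_le (by fun_prop) continuous_const

theorem dist_le_of_mem_cube {b : OrthonormalBasis (Fin d) ℝ (Pt d)} {a x : Pt d} {l : ℝ}
    (hx : x ∈ cube b a l) : dist x a ≤ d * l := by
  rw [dist_eq_norm, ← b.sum_repr' (x - a)]
  refine (norm_sum_le _ _).trans ?_
  calc ∑ i, ‖(inner ℝ (b i) (x - a) : ℝ) • b i‖ ≤ ∑ _i : Fin d, l := by
        refine Finset.sum_le_sum fun i _ => ?_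
        rw [norm_smul, b.norm_eq_one, mul_one, Real.norm_eq_abs, abs_of_nonneg (hx i).1]
        exact (hx i).2
    _ = d * l := by simp

end Trim

end MinCostMatching

/-! ### The slab bound. -/

open MinCostMatching in
theorem lemma5p2 (d : ℕ) (hd : 1 ≤ d) :
    ∃ C : ℝ, ∀ (l w : ℝ), 0 < l → 0 < w →
      ∀ (b : OrthonormalBasis (Fin d) ℝ (Pt d)) (a : Pt d)
        (P : Finset (Pt d)) (M : Finset (Sym2 (Pt d))),
        (P : Set (Pt d)) ⊆ cube b a l → IsMinCostMatching P M →
        ∀ (u : Pt d) (c : ℝ), ‖u‖ = 1 →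
          rho w (slab u c w ∩ cube b a l) M ≤ C * l ^ (d - 1) * w := by
  classical
  obtain ⟨n, rfl⟩ : ∃ n, d = n + 1 := ⟨d - 1, by omega⟩
  -- The last two factors come from applying the slab estimate with `R = 4 * ((n + 1) * l)` and `W =
  -- 4 * w`.
  refine ⟨2 * 64 ^ (2 * (n + 1)) * (2 / ballRatio n) ^ (n + 1) * (4 * (n + 1)) ^ n * 4, ?_⟩
  intro l w hl hw b a P M hPM hM u c hu
  set O := slab u c w ∩ cube b a l with hOdef
  have hO : IsClosed O := (isClosed_slab u c w).inter (isClosed_cube b a l)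
  have hends : ∀ e : Sym2 (Pt (n + 1)), ∃ p q, s(p, q) = e := fun e =>
    Sym2.ind (fun p q => ⟨p, q, rfl⟩) e
  choose p q hpq using hends
  set N := M.filter fun e => (segment ℝ (p e) (q e) ∩ O).Nonempty with hN
  have htrim : ∀ e : N, ∃ p' q', p' ∈ O ∧
      dist (p e) (q e) = dist (p e) p' + dist p' q' + dist q' (q e) ∧
      dist p' q' = min (2 * w) (clippedLength O e.1) := fun e => by
    have := exists_trim hO (Finset.mem_filter.1 e.2).2 (W := 2 * w) (by positivity)
    rwa [hpq] at this
  choose p' q' hp' hsplit hlen using htrim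
  have hopt : AltOptimal p' q' := by
    refine AltOptimal.trim (hM.altOptimal (fun e : N => p e) (fun e : N => q e) (fun e => ?_)
      fun e f hef => ?_) hsplit
    · rw [hpq]
      exact (Finset.mem_filter.1 e.2).1
    · exact Subtype.ext (by simpa only [hpq] using hef)
  have hcube : ∀ e ∈ M, dist (p e) (q e) ≤ 2 * ((n + 1) * l) := fun e he => by
    have hpe := Sym2.mem_mk_left (p e) (q e)
    have hqe := Sym2.mem_mk_right (p e) (q e)
    rw [hpq] at hpe hqe
    have h1 : dist (p e) a ≤ ((n + 1 : ℕ) : ℝ) * l := dist_le_of_mem_cube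
      (hPM (hM.1.mem_of_mem e he _ hpe))
    have h2 : dist (q e) a ≤ ((n + 1 : ℕ) : ℝ) * l := dist_le_of_mem_cube
      (hPM (hM.1.mem_of_mem e he _ hqe))
    push_cast at h1 h2
    linarith [dist_triangle_right (p e) (q e) a]
  have hmid : ∀ e : N, dist (midpoint ℝ (p' e) (q' e)) (p' e) = dist (p' e) (q' e) / 2 :=
    fun e => by
      rw [dist_midpoint_left]; norm_num; ring
  -- A trimmed edge starts in the slab and has length at most `2 * w`, so midpoint offset plus
  -- length is at most `w + w + 2 * w`. Likewise `R` is `(n + 1) * l` for the start plus `3 / 2`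
  -- times the length bound `2 * ((n + 1) * l)`.
  have key := hopt.sum_pow_le_of_slab (n := n) (by simp) Finset.univ hu c a
    (W := 4 * w) (R := 4 * ((n + 1) * l)) (by positivity) (by positivity)
    (fun e _ => by
      have h1 : |(inner ℝ u (p' e) : ℝ) - c| ≤ w := (hp' e).1
      have h2 := abs_inner_le hu (midpoint ℝ (p' e) (q' e) - p' e)
      rw [← dist_eq_norm, hmid, inner_sub_right] at h2
      have h3 := abs_sub_le (inner ℝ u (midpoint ℝ (p' e) (q' e)) : ℝ) (inner ℝ u (p' e)) c
      have h4 : dist (p' e) (q' e) ≤ 2 * w := (hlen e).trans_le (min_le_left _ _)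
      linarith)
    (fun e _ => by
      have h1 : dist (p' e) a ≤ ((n + 1 : ℕ) : ℝ) * l := dist_le_of_mem_cube (hp' e).2
      push_cast at h1
      have h2 := dist_triangle (midpoint ℝ (p' e) (q' e)) (p' e) a
      have h3 := hcube e (Finset.mem_filter.1 e.2).1
      rw [hsplit] at h3
      linarith [hmid e, dist_nonneg (x := p e) (y := p' e), dist_nonneg (x := q' e) (y := q e)])
  have hrho : rho w O M = ∑ e : N, dist (p' e) (q' e) ^ (n + 1) := by
    have h1 : ∀ e ∈ M, e ∉ N → min ((2 * w) ^ (n + 1)) (clippedLength O e ^ (n + 1)) = 0 :=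
      fun e he heN => by
        have h2 : ¬ (segment ℝ (p e) (q e) ∩ O).Nonempty := fun h =>
          heN (Finset.mem_filter.2 ⟨he, h⟩)
        have h3 : clippedLength O e = 0 := by
          conv_lhs => rw [← hpq e]
          simp only [clippedLength, Sym2.lift_mk, if_neg h2]
        rw [h3, zero_pow n.succ_ne_zero]
        exact min_eq_right (by positivity)
    rw [rho, ← Finset.sum_subset (Finset.filter_subset _ _) h1, ← Finset.sum_coe_sort]
    refine Finset.sum_congr rfl fun e _ => ?_
    have h0 : 0 ≤ clippedLength O e.1 := by
      conv_rhs => rw [← hpq e.1]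
      simp only [clippedLength, Sym2.lift_mk]
      split_ifs <;> positivity
    rw [hlen]
    rcases le_total (2 * w) (clippedLength O e.1) with h | h
    · rw [min_eq_left h, min_eq_left (pow_le_pow_left₀ (by positivity) h _)]
    · rw [min_eq_right h, min_eq_right (pow_le_pow_left₀ h0 h _)]
  rw [hrho]
  refine key.trans (le_of_eq ?_)
  rw [Nat.add_sub_cancel, ← mul_assoc 4, mul_pow]
  ring
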